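/- Let $(\widetilde{\mathcal M},g)$ be a closed (compact, without boundary) Riemannian surface of class $C^3$ with metric of class $C^2$, let $\gamma:[a,b]\to\widetilde{\mathcal M}$ be a piecewise smooth curve (continuous, and of class $C^2$ on each closed interval of a finite partition of $[a,b]$), let $F:\widetilde{\mathcal M}\to\mathbb R^N$ be an isometric embedding of class $C^3$, and put $\mathcal M:=F(\widetilde{\mathcal M})$. Then $$\mathrm{TC}_{\widetilde{\mathcal M}}(\gamma)=\mathrm{TC}_{\mathcal M}(F\circ\gamma)\in[0,\infty].$$ In particular, the right-hand side does not depend on $F$: if $F_1:\widetilde{\mathcal M}\to\mathbb R^{N_1}$ and $F_2:\widetilde{\mathcal M}\to\mathbb R^{N_2}$ are two such embeddings, then $\mathrm{TC}_{F_1(\widetilde{\mathcal M})}(F_1\circ\gamma)=\mathrm{TC}_{F_2(\widetilde{\mathcal M})}(F_2\circ\gamma)$. Here, for a curve $c:[a,b]\to S$ in $S=\widetilde{\mathcal M}$ or $S=\mathcal M$, a polygonal $P$ inscribed in $c$ is obtained by choosing $a\le t_0<t_1<\dots<t_n\le b$ with $c(t_i)\neq c(t_{i+1})$ and joining the consecutive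 points $c(t_i)$ by geodesic segments of $S$. Its rotation $k_S(P)$ is the sum of the turning angles in $[0,\pi]$ between consecutive segments at the vertices $c(t_1),\dots,c(t_{n-1})$, its modulus $\mu_c(P)$ is the maximum over $i$ of the geodesic diameter (with respect to the geodesic distance of $S$) of the arc $c([t_i,t_{i+1}])$, and $$\mathrm{TC}_S(c):=\lim_{\varepsilon\to0^+}\sup\{k_S(P)\mid P \text{ inscribed in } c,\ \mu_c(P)<\varepsilon\}.$$ The geodesic distance is the infimum of the lengths of the $C^1$ curves in $S$ joining two points, and a geodesic segment is a geodesic arc of class $C^2$ whose length is the geodesic distance of its endpoints. In $\widetilde{\mathcal M}$ lengths and angles are those of $g$, and geodesics are the solutions of $\nabla_{\dot\sigma}\dot\sigma=0$ for the Levi-Civita connection of $g$; in $\mathcal M$ lengths and angles are those of $\mathbb R^N$, and geodesics are the curves $\sigma$ in $\mathcal M$ with $\ddot\sigma\perp T_\sigma\mathcal M$. -/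

import Mathlib

open Set Filter Topology Manifold Bundle
open scoped ENNReal ContDiff

noncomputable section

namespace CurveOnSurface

/-! ### Inscribed polygonals and total intrinsic curvature

The same definition is used for curves in an abstract Riemannian surface and for curves in a
surface of a Euclidean space. The geometry enters through

* `d x y`, the geodesic distance,
* `Seg P r s`, saying that the restriction of `P` to `[r, s]` is a geodesic segment,
* `turn P r s t`, the turning angle at time `s` between the arcs `P|[r, s]` and `P|[s, t]`. -/

section Polygonals

variable {X : Type*}

/-- `P`, with the vertex times `t 0 < t 1 < ⋯ < t n`, is a polygonal inscribed in the curve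
`γ : [a, b] → X`: the times form a partition in `[a, b]`, and `P` connects the consecutive
(distinct) points `γ (t i)`, `γ (t (i + 1))` by a geodesic segment parametrized on
`[t i, t (i + 1)]`. -/
structure IsInscribedPolygonal (Seg : (ℝ → X) → ℝ → ℝ → Prop) (γ : ℝ → X) (a b : ℝ)
    (n : ℕ) (t : ℕ → ℝ) (P : ℝ → X) : Prop where
  left_le : a ≤ t 0
  le_right : t n ≤ b
  lt_succ : ∀ i < n, t i < t (i + 1)
  vertex : ∀ i ≤ n, P (t i) = γ (t i)
  ne_succ : ∀ i < n, γ (t i) ≠ γ (t (i + 1))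
  segment : ∀ i < n, Seg P (t i) (t (i + 1))

/-- The modulus of an inscribed polygonal: the greatest geodesic diameter of the arcs
`γ|[t i, t (i + 1)]` of the curve determined by consecutive vertices. -/
def modulus (d : X → X → ℝ≥0∞) (γ : ℝ → X) (n : ℕ) (t : ℕ → ℝ) : ℝ≥0∞ :=
  ⨆ i < n, ⨆ u ∈ Icc (t i) (t (i + 1)), ⨆ v ∈ Icc (t i) (t (i + 1)), d (γ u) (γ v)

/-- The rotation of a polygonal: the sum of the turning angles at its interior vertices
`P (t 1), …, P (t (n - 1))`. -/
def rotation (turn : (ℝ → X) → ℝ → ℝ → ℝ → ℝ) (n : ℕ) (t : ℕ → ℝ) (P : ℝ → X) : ℝ :=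
  ∑ i ∈ Finset.range (n - 1), turn P (t i) (t (i + 1)) (t (i + 2))

/-- The supremum of the rotations of the inscribed polygonals of modulus less than `ε`. -/
def supRotation (d : X → X → ℝ≥0∞) (Seg : (ℝ → X) → ℝ → ℝ → Prop)
    (turn : (ℝ → X) → ℝ → ℝ → ℝ → ℝ) (γ : ℝ → X) (a b : ℝ) (ε : ℝ) : ℝ≥0∞ :=
  ⨆ (n : ℕ) (t : ℕ → ℝ) (P : ℝ → X) (_ : IsInscribedPolygonal Seg γ a b n t P)
    (_ : modulus d γ n t < ENNReal.ofReal ε), ENNReal.ofReal (rotation turn n t P)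

/-- The total curvature: the limit as `ε → 0⁺` of `supRotation … ε`. It is written as an infimum
over `ε > 0`; see `tendsto_supRotation`. -/
def totalCurvature (d : X → X → ℝ≥0∞) (Seg : (ℝ → X) → ℝ → ℝ → Prop)
    (turn : (ℝ → X) → ℝ → ℝ → ℝ → ℝ) (γ : ℝ → X) (a b : ℝ) : ℝ≥0∞ :=
  ⨅ ε > (0 : ℝ), supRotation d Seg turn γ a b ε

theorem tendsto_supRotation (d : X → X → ℝ≥0∞) (Seg : (ℝ → X) → ℝ → ℝ → Prop)
    (turn : (ℝ → X) → ℝ → ℝ → ℝ → ℝ) (γ : ℝ → X) (a b : ℝ) :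
    Tendsto (supRotation d Seg turn γ a b) (𝓝[>] 0)
      (𝓝 (totalCurvature d Seg turn γ a b)) := by
  have hm : Monotone (supRotation d Seg turn γ a b) := by
    intro ε ε' h
    refine iSup_mono fun n => iSup_mono fun t => iSup_mono fun P => iSup_mono fun _ => ?_
    exact iSup_mono' fun hε => ⟨hε.trans_le (ENNReal.ofReal_le_ofReal h), le_rfl⟩
  have := hm.tendsto_nhdsGT 0
  rwa [sInf_image] at this

end Polygonals

/-! ### Abstract Riemannian surfaces -/

section Intrinsic

variable {M : Type*} [TopologicalSpace M] [ChartedSpace (EuclideanSpace ℝ (Fin 2)) M]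

/-- A piecewise smooth (piecewise `C²`) curve `γ : [a, b] → M`: it is continuous, and for some
partition `a = τ 0 < ⋯ < τ m = b` it is `C²` on each closed interval `[τ i, τ (i + 1)]`. -/
def IsPiecewiseSmooth (γ : ℝ → M) (a b : ℝ) : Prop :=
  ContinuousOn γ (Icc a b) ∧ ∃ (m : ℕ) (τ : ℕ → ℝ), τ 0 = a ∧ τ m = b ∧
    ∀ i < m, τ i < τ (i + 1) ∧ ContMDiffOn 𝓘(ℝ, ℝ) (𝓡 2) 2 γ (Icc (τ i) (τ (i + 1)))

variable [RiemannianBundle (fun x : M => TangentSpace (𝓡 2) x)]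

/-- The coordinate vector field `∂ᵢ` of the chart around `x₀`, at the point with coordinates
`y`. -/
def coordVector (x₀ : M) (y : EuclideanSpace ℝ (Fin 2)) (i : Fin 2) :
    TangentSpace (𝓡 2) ((extChartAt (𝓡 2) x₀).symm y) :=
  mfderiv 𝓘(ℝ, EuclideanSpace ℝ (Fin 2)) (𝓡 2) (extChartAt (𝓡 2) x₀).symm y
    (EuclideanSpace.single i (1 : ℝ))

/-- The matrix `(g_{ij})` of the Riemannian metric in the chart around `x₀`, as a function of the
coordinates `y`. -/
def gramMatrix (x₀ : M) (y : EuclideanSpace ℝ (Fin 2)) : Matrix (Fin 2) (Fin 2) ℝ :=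
  Matrix.of fun i j => inner ℝ (coordVector x₀ y i) (coordVector x₀ y j)

/-- The partial derivative `∂_l g_{ij}` in the chart around `x₀`. -/
def gramDeriv (x₀ : M) (l i j : Fin 2) (y : EuclideanSpace ℝ (Fin 2)) : ℝ :=
  fderiv ℝ (fun z => gramMatrix x₀ z i j) y (EuclideanSpace.single l (1 : ℝ))

/-- The Christoffel symbol `Γ^k_{ij}` of the Levi-Civita connection in the chart around `x₀`. -/
def christoffel (x₀ : M) (k i j : Fin 2) (y : EuclideanSpace ℝ (Fin 2)) : ℝ :=
  (1 / 2) * ∑ l, (gramMatrix x₀ y)⁻¹ k l *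
    (gramDeriv x₀ i j l y + gramDeriv x₀ j i l y - gramDeriv x₀ l i j y)

/-- The `k`-th coordinate of the curve `σ` in the chart around `x₀`. -/
def coordCurve (x₀ : M) (σ : ℝ → M) (k : Fin 2) (s : ℝ) : ℝ :=
  extChartAt (𝓡 2) x₀ (σ s) k

/-- The `k`-th component of the covariant acceleration `∇_{σ'} σ'` of `σ` at time `s`, in the
chart around the point `σ s`. -/
def covariantAcceleration (σ : ℝ → M) (s : ℝ) (k : Fin 2) : ℝ :=
  deriv (deriv (coordCurve (σ s) σ k)) s +
    ∑ i, ∑ j, christoffel (σ s) k i j (extChartAt (𝓡 2) (σ s) (σ s)) *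
      deriv (coordCurve (σ s) σ i) s * deriv (coordCurve (σ s) σ j) s

/-- `σ` restricted to `[r, s]` is a geodesic segment of the Riemannian surface `M`: a solution of
`∇_{σ'} σ' = 0` whose length is the geodesic distance of its endpoints. -/
structure IsGeodesicSegment (σ : ℝ → M) (r s : ℝ) : Prop where
  contMDiffOn : ContMDiffOn 𝓘(ℝ, ℝ) (𝓡 2) 2 σ (Icc r s)
  geodesic : ∀ u ∈ Ioo r s, ∀ k, covariantAcceleration σ u k = 0
  length_eq : pathELength (𝓡 2) σ r s = riemannianEDist (𝓡 2) (σ r) (σ s)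

/-- The angle, for the Riemannian metric, between the velocity of `P|[r, s]` and the velocity of
`P|[s, t]` at time `s`. -/
def turningAngle (P : ℝ → M) (r s t : ℝ) : ℝ :=
  InnerProductGeometry.angle
    (mfderivWithin 𝓘(ℝ, ℝ) (𝓡 2) P (Icc r s) s (1 : ℝ))
    (mfderivWithin 𝓘(ℝ, ℝ) (𝓡 2) P (Icc s t) s (1 : ℝ))

/-- The total intrinsic curvature of the curve `γ : [a, b] → M` in the Riemannian surface `M`. -/
def intrinsicTC (γ : ℝ → M) (a b : ℝ) : ℝ≥0∞ :=
  totalCurvature (riemannianEDist (𝓡 2)) IsGeodesicSegment turningAngle γ a b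

/-- A (class `C³`) isometric embedding of the Riemannian surface `M` in `ℝᴺ`. -/
structure IsIsometricEmbedding {N : ℕ} (F : M → EuclideanSpace ℝ (Fin N)) : Prop where
  isSmoothEmbedding : IsSmoothEmbedding (𝓡 2) 𝓘(ℝ, EuclideanSpace ℝ (Fin N)) 3 F
  inner_eq : ∀ (x : M) (v w : TangentSpace (𝓡 2) x),
    inner ℝ
      (show EuclideanSpace ℝ (Fin N) from
        mfderiv (𝓡 2) 𝓘(ℝ, EuclideanSpace ℝ (Fin N)) F x v)
      (show EuclideanSpace ℝ (Fin N) from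
        mfderiv (𝓡 2) 𝓘(ℝ, EuclideanSpace ℝ (Fin N)) F x w) = inner ℝ v w

end Intrinsic

/-! ### Surfaces in Euclidean space

All notions below depend only on the set `S` of points of the surface and on the Euclidean
structure of the ambient space. -/

section Extrinsic

variable {N : ℕ}

/-- The tangent space `T_p S`: the velocities at `p` of the `C¹` curves contained in `S`. -/
def tangentVectors (S : Set (EuclideanSpace ℝ (Fin N))) (p : EuclideanSpace ℝ (Fin N)) :
    Set (EuclideanSpace ℝ (Fin N)) :=
  {v | ∃ c : ℝ → EuclideanSpace ℝ (Fin N), ContDiffAt ℝ 1 c 0 ∧ c 0 = p ∧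
    (∀ᶠ s in 𝓝 0, c s ∈ S) ∧ deriv c 0 = v}

/-- The length of a curve on `[r, s]`. -/
def curveLength (c : ℝ → EuclideanSpace ℝ (Fin N)) (r s : ℝ) : ℝ≥0∞ :=
  ∫⁻ u in Icc r s, ‖deriv c u‖ₑ

/-- The geodesic distance in `S`: the infimum of the lengths of the `C¹` curves contained in `S`
and joining the two points. -/
def surfaceEDist (S : Set (EuclideanSpace ℝ (Fin N))) (p q : EuclideanSpace ℝ (Fin N)) : ℝ≥0∞ :=
  ⨅ (c : ℝ → EuclideanSpace ℝ (Fin N)) (_ : ContDiffOn ℝ 1 c (Icc 0 1))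
    (_ : ∀ u ∈ Icc (0 : ℝ) 1, c u ∈ S) (_ : c 0 = p) (_ : c 1 = q), curveLength c 0 1

/-- `c` restricted to `[r, s]` is a geodesic segment of the surface `S`: a curve in `S` whose
acceleration is orthogonal to `S` and whose length is the geodesic distance of its endpoints. -/
structure IsSurfaceGeodesicSegment (S : Set (EuclideanSpace ℝ (Fin N)))
    (c : ℝ → EuclideanSpace ℝ (Fin N)) (r s : ℝ) : Prop where
  contDiffOn : ContDiffOn ℝ 2 c (Icc r s)
  mem : ∀ u ∈ Icc r s, c u ∈ S
  geodesic : ∀ u ∈ Ioo r s, ∀ v ∈ tangentVectors S (c u), inner ℝ (deriv (deriv c) u) v = 0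
  length_eq : curveLength c r s = surfaceEDist S (c r) (c s)

/-- The Euclidean angle between the velocity of `P|[r, s]` and the velocity of `P|[s, t]` at
time `s`. -/
def euclideanTurningAngle (P : ℝ → EuclideanSpace ℝ (Fin N)) (r s t : ℝ) : ℝ :=
  InnerProductGeometry.angle (derivWithin P (Icc r s) s) (derivWithin P (Icc s t) s)

/-- The total intrinsic curvature of a curve `c : [a, b] → S` in the surface `S ⊆ ℝᴺ`. -/
def surfaceTC (S : Set (EuclideanSpace ℝ (Fin N))) (c : ℝ → EuclideanSpace ℝ (Fin N))
    (a b : ℝ) : ℝ≥0∞ :=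
  totalCurvature (surfaceEDist S) (IsSurfaceGeodesicSegment S) euclideanTurningAngle c a b

end Extrinsic

end CurveOnSurface

end

/-! Every ingredient of the total curvature is transported by `F`. Since `F` is a topological
embedding with local `C³` left inverses, a curve in `range F` is `C¹` or `C²` exactly when its lift
to `M` is. Since `dF` preserves inner products, lengths and turning angles agree, and hence so do
the two geodesic distances and the moduli.

The substantial point is the geodesic equation. For `f`, the map `F` read in a chart, the
Levi-Civita formula gives `∑ₖ g_{mk} Γᵏᵢⱼ = ⟨∂ᵢ∂ⱼf, ∂ₘf⟩` (`sum_gramMatrix_mul_christoffel`). Hence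
the tangential part of the Euclidean acceleration of `F ∘ σ` is the image of `∇_{σ'} σ'`
(`inner_acceleration`), and one vanishes exactly when the other does.

Inscribed polygonals therefore correspond with equal modulus and rotation, and the suprema agree for
every `ε`. Independence of `F` follows, as both extrinsic values equal the intrinsic one. -/

noncomputable section

namespace CurveOnSurface

/-! ### Smoothness of curves read through an embedding -/

section Smoothness

variable {N : ℕ} {M : Type*} [TopologicalSpace M] [ChartedSpace (EuclideanSpace ℝ (Fin 2)) M]
  {F : M → EuclideanSpace ℝ (Fin N)}

/-- An immersion has a local left inverse of the same class. -/
theorem exists_local_leftInverse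
    (hF : IsSmoothEmbedding (𝓡 2) 𝓘(ℝ, EuclideanSpace ℝ (Fin N)) 3 F) (x : M) :
    ∃ G : EuclideanSpace ℝ (Fin N) → M,
      ContMDiffAt 𝓘(ℝ, EuclideanSpace ℝ (Fin N)) (𝓡 2) 3 G (F x) ∧
        ∀ᶠ z in 𝓝 x, G (F z) = z := by
  have h := hF.isImmersion.isImmersionAt x
  -- In the charts adapted to the immersion, `F` is `v ↦ h.equiv (v, 0)`, so the first component of
  -- `h.equiv.symm` recovers `v`.
  have hloc : ∀ z ∈ h.domChart.source,
      (h.equiv.symm (h.codChart.extend 𝓘(ℝ, EuclideanSpace ℝ (Fin N)) (F z))).1 =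
        h.domChart.extend (𝓡 2) z := by
    intro z hz
    have hz' : h.domChart.extend (𝓡 2) z ∈ (h.domChart.extend (𝓡 2)).target :=
      (h.domChart.extend (𝓡 2)).map_source (by simpa using hz)
    have := h.writtenInCharts hz'
    simp only [Function.comp_apply] at this
    rw [h.domChart.extend_left_inv hz] at this
    rw [this]
    simp
  refine ⟨fun p => (h.domChart.extend (𝓡 2)).symm
    (h.equiv.symm (h.codChart.extend 𝓘(ℝ, EuclideanSpace ℝ (Fin N)) p)).1, ?_, ?_⟩
  · have h1 := h.codChart.contMDiffAt_extend (I := 𝓘(ℝ, EuclideanSpace ℝ (Fin N)))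
      h.codChart_mem_maximalAtlas h.mem_codChart_source
    have h2 : ContMDiffAt 𝓘(ℝ, EuclideanSpace ℝ (Fin N)) 𝓘(ℝ, EuclideanSpace ℝ (Fin 2)) 3
        (fun p => (h.equiv.symm (h.codChart.extend 𝓘(ℝ, EuclideanSpace ℝ (Fin N)) p)).1) (F x) := by
      have h3 : ContDiff ℝ 3 fun p => (h.equiv.symm p).1 := by fun_prop
      exact h3.contMDiff.contMDiffAt.comp (F x) h1
    have h4 := contMDiffOn_extend_symm (I := 𝓡 2) h.domChart_mem_maximalAtlas
    have h5 : ContMDiffAt 𝓘(ℝ, EuclideanSpace ℝ (Fin 2)) (𝓡 2) 3 (h.domChart.extend (𝓡 2)).symm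
        (h.domChart.extend (𝓡 2) x) := by
      refine h4.contMDiffAt ?_
      simpa using h.domChart.open_target.mem_nhds (h.domChart.map_source h.mem_domChart_source)
    rw [← hloc x h.mem_domChart_source] at h5
    exact h5.comp (F x) h2
  · filter_upwards [h.domChart.open_source.mem_nhds h.mem_domChart_source] with z hz
    rw [hloc z hz, h.domChart.extend_left_inv hz]

/-- Locally `σ = G ∘ c` for a `C³` left inverse `G` of `F`. Agreement is asked only on `s`, so that
the lemma serves both `c = F ∘ σ` and `σ = F⁻¹ ∘ c`, the latter being meaningful only where `c` lies
in the surface. -/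
theorem contMDiffWithinAt_iff_of_embedding
    (hF : IsSmoothEmbedding (𝓡 2) 𝓘(ℝ, EuclideanSpace ℝ (Fin N)) 3 F) {n : ℕ∞ω} (hn : n ≤ 3)
    {σ : ℝ → M} {c : ℝ → EuclideanSpace ℝ (Fin N)} {s : Set ℝ} {u : ℝ} (hu : u ∈ s)
    (h : ∀ t ∈ s, F (σ t) = c t) :
    ContMDiffWithinAt 𝓘(ℝ, ℝ) (𝓡 2) n σ s u ↔ ContDiffWithinAt ℝ n c s u := by
  constructor
  · intro hσ
    have h1 : ContMDiffWithinAt 𝓘(ℝ, ℝ) 𝓘(ℝ, EuclideanSpace ℝ (Fin N)) n (F ∘ σ) s u :=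
      ((hF.isImmersion.contMDiff.of_le hn).contMDiffAt).comp_contMDiffWithinAt u hσ
    exact (contMDiffWithinAt_iff_contDiffWithinAt.1 h1).congr_of_mem (fun t ht => (h t ht).symm) hu
  · intro hc
    -- `G` inverts `F` only near `σ u`, so `σ` must first be known to stay there; this is where the
    -- topological embedding enters.
    have hcont : ContinuousWithinAt σ s u := by
      have : ContinuousWithinAt (F ∘ σ) s u :=
        hc.continuousWithinAt.congr (fun t ht => h t ht) (h u hu)
      exact (hF.isEmbedding.isInducing.continuousWithinAt_iff).2 this
    obtain ⟨G, hG, hGF⟩ := exists_local_leftInverse hF (σ u)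
    rw [h u hu] at hG
    have h1 : ContMDiffWithinAt 𝓘(ℝ, ℝ) (𝓡 2) n (G ∘ c) s u :=
      (hG.of_le hn).comp_contMDiffWithinAt u hc.contMDiffWithinAt
    refine h1.congr_of_eventuallyEq_of_mem ?_ hu
    filter_upwards [hcont.eventually hGF, self_mem_nhdsWithin] with t ht hts
    rw [← ht, Function.comp_apply, h t hts, ← h t hts, ht]

theorem contMDiffOn_iff_of_embedding
    (hF : IsSmoothEmbedding (𝓡 2) 𝓘(ℝ, EuclideanSpace ℝ (Fin N)) 3 F) {n : ℕ∞ω} (hn : n ≤ 3)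
    {σ : ℝ → M} {c : ℝ → EuclideanSpace ℝ (Fin N)} {s : Set ℝ} (h : ∀ t ∈ s, F (σ t) = c t) :
    ContMDiffOn 𝓘(ℝ, ℝ) (𝓡 2) n σ s ↔ ContDiffOn ℝ n c s :=
  forall₂_congr fun _ hu => contMDiffWithinAt_iff_of_embedding hF hn hu h

end Smoothness

/-! ### Lengths, distances and angles under an isometric embedding -/

section Metric

variable {N : ℕ} {M : Type*} [TopologicalSpace M] [ChartedSpace (EuclideanSpace ℝ (Fin 2)) M]
  {F : M → EuclideanSpace ℝ (Fin N)}

/-- The differential of `F` at `x`, as a map into the ambient Euclidean space. -/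
def differential (F : M → EuclideanSpace ℝ (Fin N)) (x : M) :
    TangentSpace (𝓡 2) x →L[ℝ] EuclideanSpace ℝ (Fin N) :=
  mfderiv (𝓡 2) 𝓘(ℝ, EuclideanSpace ℝ (Fin N)) F x

theorem derivWithin_eq_differential
    (hF : IsSmoothEmbedding (𝓡 2) 𝓘(ℝ, EuclideanSpace ℝ (Fin N)) 3 F)
    {σ : ℝ → M} {c : ℝ → EuclideanSpace ℝ (Fin N)} {s : Set ℝ} {u : ℝ} (hu : u ∈ s)
    (hs : UniqueDiffWithinAt ℝ s u) (h : ∀ t ∈ s, F (σ t) = c t)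
    (hσ : MDifferentiableWithinAt 𝓘(ℝ, ℝ) (𝓡 2) σ s u) :
    derivWithin c s u = differential F (σ u) (mfderivWithin 𝓘(ℝ, ℝ) (𝓡 2) σ s u (1 : ℝ)) := by
  have h1 : derivWithin c s u = derivWithin (F ∘ σ) s u :=
    derivWithin_congr (fun t ht => (h t ht).symm) (h u hu).symm
  have h2 := mfderiv_comp_mfderivWithin u
    ((hF.isImmersion.contMDiff.mdifferentiable (by norm_num)) (σ u)) hσ
    (uniqueMDiffWithinAt_iff_uniqueDiffWithinAt.2 hs)
  rw [h1, ← fderivWithin_derivWithin, ← mfderivWithin_eq_fderivWithin, h2]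
  rfl

variable [RiemannianBundle (fun x : M => TangentSpace (𝓡 2) x)]

theorem IsIsometricEmbedding.inner_differential (hF : IsIsometricEmbedding F) (x : M)
    (v w : TangentSpace (𝓡 2) x) :
    inner ℝ (differential F x v) (differential F x w) = inner ℝ v w :=
  hF.inner_eq x v w

theorem IsIsometricEmbedding.norm_differential (hF : IsIsometricEmbedding F) (x : M)
    (v : TangentSpace (𝓡 2) x) : ‖differential F x v‖ = ‖v‖ := by
  rw [norm_eq_sqrt_real_inner, norm_eq_sqrt_real_inner, hF.inner_differential]

theorem IsIsometricEmbedding.enorm_differential (hF : IsIsometricEmbedding F) (x : M)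
    (v : TangentSpace (𝓡 2) x) : ‖differential F x v‖ₑ = ‖v‖ₑ := by
  rw [← ofReal_norm, ← ofReal_norm, hF.norm_differential]

theorem IsIsometricEmbedding.angle_differential (hF : IsIsometricEmbedding F) (x : M)
    (v w : TangentSpace (𝓡 2) x) :
    InnerProductGeometry.angle (differential F x v) (differential F x w) =
      InnerProductGeometry.angle v w := by
  simp only [InnerProductGeometry.angle, hF.inner_differential, hF.norm_differential]

theorem IsIsometricEmbedding.curveLength_eq (hF : IsIsometricEmbedding F) {σ : ℝ → M}
    {c : ℝ → EuclideanSpace ℝ (Fin N)} {r s : ℝ} (h : ∀ t ∈ Icc r s, F (σ t) = c t)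
    (hσ : ContMDiffOn 𝓘(ℝ, ℝ) (𝓡 2) 1 σ (Icc r s)) :
    curveLength c r s = pathELength (𝓡 2) σ r s := by
  -- At the endpoints the two-sided `deriv` is not determined by `c` on `[r, s]`; the open interval
  -- drops only a null set.
  rw [pathELength_eq_lintegral_mfderiv_Ioo, curveLength,
    ← MeasureTheory.restrict_Ioo_eq_restrict_Icc]
  refine MeasureTheory.setLIntegral_congr_fun measurableSet_Ioo fun u hu => ?_
  have hnhds := Ioo_mem_nhds hu.1 hu.2
  have := derivWithin_eq_differential hF.isSmoothEmbedding hu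
    (isOpen_Ioo.uniqueDiffOn u hu) (fun t ht => h t (Ioo_subset_Icc_self ht))
    (((hσ.mdifferentiableOn one_ne_zero).mono Ioo_subset_Icc_self) u hu)
  rw [derivWithin_of_mem_nhds hnhds, mfderivWithin_of_mem_nhds hnhds] at this
  rw [this]
  exact hF.enorm_differential _ _

/-- The competitors correspond: `C¹` curves in `M` map to `C¹` curves in `range F` of the same
length, and `F⁻¹` lifts the latter back. -/
theorem IsIsometricEmbedding.surfaceEDist_eq (hF : IsIsometricEmbedding F) (x y : M) :
    surfaceEDist (range F) (F x) (F y) = riemannianEDist (𝓡 2) x y := by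
  apply le_antisymm
  · refine le_of_forall_gt fun r hr => ?_
    obtain ⟨σ, h0, h1, hσ, hr⟩ := exists_lt_of_riemannianEDist_lt hr
    rw [← hF.curveLength_eq (fun _ _ => rfl) hσ] at hr
    refine lt_of_le_of_lt ?_ hr
    refine iInf₂_le_of_le (fun t => F (σ t)) ?_ ?_
    · exact (contMDiffOn_iff_of_embedding hF.isSmoothEmbedding (by norm_num)
        (fun _ _ => rfl)).1 hσ
    · exact iInf₂_le_of_le (fun u _ => mem_range_self _) (congrArg F h0)
        (iInf_le_of_le (congrArg F h1) le_rfl)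
  · refine le_iInf₂ fun c hc => le_iInf₂ fun hS h0 => le_iInf fun h1 => ?_
    have : Nonempty M := ⟨x⟩
    have hinj := hF.isSmoothEmbedding.isEmbedding.injective
    have h : ∀ t ∈ Icc (0 : ℝ) 1, F (Function.invFun F (c t)) = c t :=
      fun t ht => Function.invFun_eq (hS t ht)
    have hσ : ContMDiffOn 𝓘(ℝ, ℝ) (𝓡 2) 1 (fun t => Function.invFun F (c t)) (Icc 0 1) :=
      (contMDiffOn_iff_of_embedding hF.isSmoothEmbedding (by norm_num) h).2 hc
    rw [hF.curveLength_eq h hσ]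
    refine riemannianEDist_le_pathELength hσ ?_ ?_ zero_le_one
    · rw [h0, Function.leftInverse_invFun hinj]
    · rw [h1, Function.leftInverse_invFun hinj]

theorem IsIsometricEmbedding.euclideanTurningAngle_eq (hF : IsIsometricEmbedding F) {σ : ℝ → M}
    {c : ℝ → EuclideanSpace ℝ (Fin N)} {r s t : ℝ} (hrs : r < s) (hst : s < t)
    (h₁ : ∀ u ∈ Icc r s, F (σ u) = c u) (h₂ : ∀ u ∈ Icc s t, F (σ u) = c u)
    (hσ₁ : ContMDiffOn 𝓘(ℝ, ℝ) (𝓡 2) 2 σ (Icc r s))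
    (hσ₂ : ContMDiffOn 𝓘(ℝ, ℝ) (𝓡 2) 2 σ (Icc s t)) :
    euclideanTurningAngle c r s t = turningAngle σ r s t := by
  have hs₁ : s ∈ Icc r s := right_mem_Icc.2 hrs.le
  have hs₂ : s ∈ Icc s t := left_mem_Icc.2 hst.le
  rw [euclideanTurningAngle, turningAngle,
    derivWithin_eq_differential hF.isSmoothEmbedding hs₁ (uniqueDiffOn_Icc hrs s hs₁) h₁
      (hσ₁.mdifferentiableOn two_ne_zero s hs₁),
    derivWithin_eq_differential hF.isSmoothEmbedding hs₂ (uniqueDiffOn_Icc hst s hs₂) h₂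
      (hσ₂.mdifferentiableOn two_ne_zero s hs₂), hF.angle_differential]

end Metric

/-! ### The geodesic equation under an isometric embedding -/

section Calculus

variable {E G : Type*} [NormedAddCommGroup E] [NormedSpace ℝ E]
  [NormedAddCommGroup G] [NormedSpace ℝ G]

theorem differentiableAt_deriv_of_contDiffAt {y : ℝ → E} {u : ℝ} (hy : ContDiffAt ℝ 2 y u) :
    DifferentiableAt ℝ (deriv y) u :=
  ((hy.fderiv_right (m := 1) (by norm_num)).differentiableAt one_ne_zero).clm_apply
    (differentiableAt_const (1 : ℝ))

/-- The acceleration of a curve `f ∘ y` in terms of the velocity and acceleration of `y`. -/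
theorem deriv_deriv_comp {f : E → G} {y : ℝ → E} {u : ℝ} (hf : ContDiffAt ℝ 2 f (y u))
    (hy : ContDiffAt ℝ 2 y u) :
    deriv (deriv (f ∘ y)) u = fderiv ℝ f (y u) (deriv (deriv y) u) +
      fderiv ℝ (fderiv ℝ f) (y u) (deriv y u) (deriv y u) := by
  have h1 : deriv (f ∘ y) =ᶠ[𝓝 u] fun t => fderiv ℝ f (y t) (deriv y t) := by
    filter_upwards [hy.continuousAt.eventually (hf.eventually (by simp)),
      hy.eventually (by simp)] with t ht ht'
    exact fderiv_comp_deriv t (ht.differentiableAt two_ne_zero) (ht'.differentiableAt two_ne_zero)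
  have hfd : DifferentiableAt ℝ (fderiv ℝ f) (y u) :=
    (hf.fderiv_right (m := 1) (by norm_num)).differentiableAt one_ne_zero
  have hyd : DifferentiableAt ℝ (deriv y) u :=
    differentiableAt_deriv_of_contDiffAt hy
  have h2 : HasDerivAt (fun t => fderiv ℝ f (y t))
      (fderiv ℝ (fderiv ℝ f) (y u) (deriv y u)) u :=
    hfd.hasFDerivAt.comp_hasDerivAt u (hy.differentiableAt two_ne_zero).hasDerivAt
  rw [h1.deriv_eq, (h2.clm_apply hyd.hasDerivAt).deriv, add_comm]

end Calculus

section Geodesic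

variable {N : ℕ} {M : Type*} [TopologicalSpace M] [ChartedSpace (EuclideanSpace ℝ (Fin 2)) M]
  {F : M → EuclideanSpace ℝ (Fin N)}

/-- The map `F` read in the chart around `x₀`. -/
def localParam (F : M → EuclideanSpace ℝ (Fin N)) (x₀ : M) :
    EuclideanSpace ℝ (Fin 2) → EuclideanSpace ℝ (Fin N) :=
  F ∘ (extChartAt (𝓡 2) x₀).symm

variable [IsManifold (𝓡 2) 3 M]

theorem contDiffAt_localParam
    (hF : IsSmoothEmbedding (𝓡 2) 𝓘(ℝ, EuclideanSpace ℝ (Fin N)) 3 F) (x₀ : M)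
    {y : EuclideanSpace ℝ (Fin 2)} (hy : y ∈ (extChartAt (𝓡 2) x₀).target) :
    ContDiffAt ℝ 3 (localParam F x₀) y := by
  have h1 : ContMDiffAt 𝓘(ℝ, EuclideanSpace ℝ (Fin 2)) (𝓡 2) 3 (extChartAt (𝓡 2) x₀).symm y :=
    (contMDiffOn_extChartAt_symm x₀).contMDiffAt ((isOpen_extChartAt_target x₀).mem_nhds hy)
  exact (hF.isImmersion.contMDiff.contMDiffAt.comp y h1).contDiffAt

theorem fderiv_localParam
    (hF : IsSmoothEmbedding (𝓡 2) 𝓘(ℝ, EuclideanSpace ℝ (Fin N)) 3 F) (x₀ : M)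
    {y : EuclideanSpace ℝ (Fin 2)} (hy : y ∈ (extChartAt (𝓡 2) x₀).target)
    (v : EuclideanSpace ℝ (Fin 2)) :
    fderiv ℝ (localParam F x₀) y v = differential F ((extChartAt (𝓡 2) x₀).symm y)
      (mfderiv 𝓘(ℝ, EuclideanSpace ℝ (Fin 2)) (𝓡 2) (extChartAt (𝓡 2) x₀).symm y v) := by
  have h1 : ContMDiffAt 𝓘(ℝ, EuclideanSpace ℝ (Fin 2)) (𝓡 2) 3 (extChartAt (𝓡 2) x₀).symm y :=
    (contMDiffOn_extChartAt_symm x₀).contMDiffAt ((isOpen_extChartAt_target x₀).mem_nhds hy)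
  have h2 := mfderiv_comp y
    ((hF.isImmersion.contMDiff.mdifferentiable (by norm_num)) ((extChartAt (𝓡 2) x₀).symm y))
    (h1.mdifferentiableAt (by norm_num))
  rw [← mfderiv_eq_fderiv, localParam, h2]
  rfl

/-- Lifting a curve of the surface to coordinates and applying the chain rule gives one inclusion;
images of coordinate lines give the other. It shows that the velocities form a linear space, so
orthogonality can be tested on `∂₀f` and `∂₁f`. -/
theorem tangentVectors_range
    (hF : IsSmoothEmbedding (𝓡 2) 𝓘(ℝ, EuclideanSpace ℝ (Fin N)) 3 F) (x : M) :
    tangentVectors (range F) (F x) =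
      range (fderiv ℝ (localParam F x) (extChartAt (𝓡 2) x x)) := by
  have hf := contDiffAt_localParam hF x (mem_extChartAt_target (I := 𝓡 2) x)
  have hfx : localParam F x (extChartAt (𝓡 2) x x) = F x := by
    simp [localParam]
  ext v
  constructor
  · rintro ⟨c, hc, h0, hS, rfl⟩
    have : Nonempty M := ⟨x⟩
    obtain ⟨s, hs, hsF⟩ := eventually_iff_exists_mem.1 hS
    have hinv : ∀ t ∈ s, F (Function.invFun F (c t)) = c t :=
      fun t ht => Function.invFun_eq (hsF t ht)
    have hx : Function.invFun F (c 0) = x := by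
      rw [h0, Function.leftInverse_invFun hF.isEmbedding.injective]
    have hσ : ContMDiffAt 𝓘(ℝ, ℝ) (𝓡 2) 1 (fun t => Function.invFun F (c t)) 0 :=
      ((contMDiffWithinAt_iff_of_embedding hF (by norm_num) (mem_of_mem_nhds hs) hinv).2
        hc.contDiffWithinAt).contMDiffAt hs
    have hext : ContMDiffAt (𝓡 2) 𝓘(ℝ, EuclideanSpace ℝ (Fin 2)) 1 (extChartAt (𝓡 2) x)
        (Function.invFun F (c 0)) := by
      rw [hx]
      exact (contMDiffAt_extChartAt (n := 3)).of_le (by norm_num)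
    have hy : ContDiffAt ℝ 1 (fun t => extChartAt (𝓡 2) x (Function.invFun F (c t))) 0 :=
      (hext.comp (0 : ℝ) hσ).contDiffAt
    have hcy : c =ᶠ[𝓝 0]
        localParam F x ∘ fun t => extChartAt (𝓡 2) x (Function.invFun F (c t)) := by
      have hmem : ∀ᶠ t in 𝓝 (0 : ℝ), Function.invFun F (c t) ∈ (extChartAt (𝓡 2) x).source :=
        hσ.continuousAt.eventually (by simp only [hx]; exact extChartAt_source_mem_nhds x)
      filter_upwards [hs, hmem] with t ht ht'
      simp only [localParam, Function.comp_apply, (extChartAt (𝓡 2) x).left_inv ht', hinv t ht]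
    refine ⟨deriv (fun t => extChartAt (𝓡 2) x (Function.invFun F (c t))) 0, ?_⟩
    rw [hcy.deriv_eq, fderiv_comp_deriv, hx]
    · rw [hx]
      exact hf.differentiableAt (by norm_num)
    · exact hy.differentiableAt one_ne_zero
  · rintro ⟨w, rfl⟩
    have hline : ContDiff ℝ 1 fun t : ℝ => extChartAt (𝓡 2) x x + t • w := by fun_prop
    have hd : HasDerivAt (fun t : ℝ => extChartAt (𝓡 2) x x + t • w) w 0 := by
      simpa using ((hasDerivAt_id (0 : ℝ)).smul_const w).const_add (extChartAt (𝓡 2) x x)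
    have hy0 : extChartAt (𝓡 2) x x + (0 : ℝ) • w = extChartAt (𝓡 2) x x := by simp
    -- `localParam` takes values in `range F` even outside the chart target, so the curve lies in
    -- the surface for every `t`.
    refine ⟨fun t => localParam F x (extChartAt (𝓡 2) x x + t • w), ?_, ?_,
      Eventually.of_forall fun t => mem_range_self _, ?_⟩
    · refine ContDiffAt.comp (g := localParam F x) (0 : ℝ) ?_ hline.contDiffAt
      rw [hy0]
      exact hf.of_le (by norm_num)
    · simp only [hy0, hfx]
    · refine HasDerivAt.deriv (HasFDerivAt.comp_hasDerivAt (l := localParam F x) (0 : ℝ) ?_ hd)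
      rw [hy0]
      exact (hf.differentiableAt (by norm_num)).hasFDerivAt

variable [RiemannianBundle (fun x : M => TangentSpace (𝓡 2) x)]

theorem IsIsometricEmbedding.gramMatrix_eq (hF : IsIsometricEmbedding F) (x₀ : M)
    {y : EuclideanSpace ℝ (Fin 2)} (hy : y ∈ (extChartAt (𝓡 2) x₀).target) (i j : Fin 2) :
    gramMatrix x₀ y i j =
      inner ℝ (fderiv ℝ (localParam F x₀) y (EuclideanSpace.single i (1 : ℝ)))
        (fderiv ℝ (localParam F x₀) y (EuclideanSpace.single j (1 : ℝ))) := by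
  rw [fderiv_localParam hF.isSmoothEmbedding x₀ hy, fderiv_localParam hF.isSmoothEmbedding x₀ hy,
    hF.inner_differential]
  rfl

theorem IsIsometricEmbedding.gramDeriv_eq (hF : IsIsometricEmbedding F) (x₀ : M)
    {y : EuclideanSpace ℝ (Fin 2)} (hy : y ∈ (extChartAt (𝓡 2) x₀).target) (l i j : Fin 2) :
    gramDeriv x₀ l i j y =
      inner ℝ (fderiv ℝ (localParam F x₀) y (EuclideanSpace.single i (1 : ℝ)))
        (fderiv ℝ (fderiv ℝ (localParam F x₀)) y (EuclideanSpace.single l (1 : ℝ))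
          (EuclideanSpace.single j (1 : ℝ))) +
      inner ℝ (fderiv ℝ (fderiv ℝ (localParam F x₀)) y (EuclideanSpace.single l (1 : ℝ))
          (EuclideanSpace.single i (1 : ℝ)))
        (fderiv ℝ (localParam F x₀) y (EuclideanSpace.single j (1 : ℝ))) := by
  have h1 : (fun z => gramMatrix x₀ z i j) =ᶠ[𝓝 y] fun z =>
      inner ℝ (fderiv ℝ (localParam F x₀) z (EuclideanSpace.single i (1 : ℝ)))
        (fderiv ℝ (localParam F x₀) z (EuclideanSpace.single j (1 : ℝ))) := by
    filter_upwards [(isOpen_extChartAt_target x₀).mem_nhds hy] with z hz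
    exact hF.gramMatrix_eq x₀ hz i j
  have hfd : DifferentiableAt ℝ (fderiv ℝ (localParam F x₀)) y :=
    ((contDiffAt_localParam hF.isSmoothEmbedding x₀ hy).fderiv_right (m := 2)
      (by norm_num)).differentiableAt two_ne_zero
  have h2 : ∀ v : EuclideanSpace ℝ (Fin 2), HasFDerivAt (fun z => fderiv ℝ (localParam F x₀) z v)
      ((fderiv ℝ (fderiv ℝ (localParam F x₀)) y).flip v) y := fun v => by
    simpa using hfd.hasFDerivAt.clm_apply (hasFDerivAt_const v y)
  rw [gramDeriv, h1.fderiv_eq, ((h2 _).inner ℝ (h2 _)).fderiv]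
  simp [fderivInnerCLM_apply]

/-- A kernel vector `w` of the Gram matrix satisfies `|df w|² = wᵀ g w = 0`; as `dF` preserves norms
and the chart differential is invertible, `w = 0`. -/
theorem IsIsometricEmbedding.det_gramMatrix_ne_zero (hF : IsIsometricEmbedding F) (x₀ : M)
    {y : EuclideanSpace ℝ (Fin 2)} (hy : y ∈ (extChartAt (𝓡 2) x₀).target) :
    (gramMatrix x₀ y).det ≠ 0 := by
  intro hdet
  obtain ⟨v, hv, hgv⟩ := Matrix.exists_mulVec_eq_zero_iff.2 hdet
  set w : EuclideanSpace ℝ (Fin 2) := WithLp.toLp 2 v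
  have hw : w = ∑ i, v i • EuclideanSpace.single i (1 : ℝ) := by
    ext k; fin_cases k <;> simp [w, Fin.sum_univ_two]
  have h1 : inner ℝ (fderiv ℝ (localParam F x₀) y w) (fderiv ℝ (localParam F x₀) y w) = 0 := by
    have e0 := congrFun hgv 0
    have e1 := congrFun hgv 1
    simp only [Matrix.mulVec, dotProduct, Fin.sum_univ_two, hF.gramMatrix_eq x₀ hy,
      Pi.zero_apply] at e0 e1
    rw [hw]
    simp only [Fin.sum_univ_two, map_add, map_smul, inner_add_left, inner_add_right,
      real_inner_smul_left, real_inner_smul_right]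
    linear_combination v 0 * e0 + v 1 * e1
  have h2 : differential F ((extChartAt (𝓡 2) x₀).symm y)
      (mfderiv 𝓘(ℝ, EuclideanSpace ℝ (Fin 2)) (𝓡 2) (extChartAt (𝓡 2) x₀).symm y w) = 0 := by
    rw [← fderiv_localParam hF.isSmoothEmbedding x₀ hy]
    exact inner_self_eq_zero.1 h1
  have h3 : mfderiv 𝓘(ℝ, EuclideanSpace ℝ (Fin 2)) (𝓡 2) (extChartAt (𝓡 2) x₀).symm y w = 0 := by
    rw [← norm_eq_zero, ← hF.norm_differential, h2, norm_zero]
  have h4 := isInvertible_mfderivWithin_extChartAt_symm (I := 𝓡 2) hy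
  rw [modelWithCornersSelf_coe, range_id, mfderivWithin_univ] at h4
  have h5 : w = 0 := h4.injective (h3.trans (map_zero _).symm)
  apply hv
  ext k
  simpa [w] using congrArg (fun z : EuclideanSpace ℝ (Fin 2) => z k) h5

/-- Multiplying by `g` cancels `g⁻¹`, which is a genuine inverse since `det g ≠ 0`. By the product
rule and symmetry of second derivatives, `∂ᵢg_{jm} + ∂ⱼg_{im} - ∂ₘg_{ij} = 2⟨∂ᵢ∂ⱼf, ∂ₘf⟩`. -/
theorem IsIsometricEmbedding.sum_gramMatrix_mul_christoffel (hF : IsIsometricEmbedding F) (x₀ : M)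
    {y : EuclideanSpace ℝ (Fin 2)} (hy : y ∈ (extChartAt (𝓡 2) x₀).target) (m i j : Fin 2) :
    ∑ k, gramMatrix x₀ y m k * christoffel x₀ k i j y =
      inner ℝ (fderiv ℝ (fderiv ℝ (localParam F x₀)) y (EuclideanSpace.single i (1 : ℝ))
          (EuclideanSpace.single j (1 : ℝ)))
        (fderiv ℝ (localParam F x₀) y (EuclideanSpace.single m (1 : ℝ))) := by
  set T : Fin 2 → ℝ := fun l =>
    gramDeriv x₀ i j l y + gramDeriv x₀ j i l y - gramDeriv x₀ l i j y with hT
  have hunit : IsUnit (gramMatrix x₀ y).det := (hF.det_gramMatrix_ne_zero x₀ hy).isUnit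
  have h1 : ∑ k, gramMatrix x₀ y m k * christoffel x₀ k i j y = (1 / 2) * T m := by
    have h2 : (gramMatrix x₀ y).mulVec ((gramMatrix x₀ y)⁻¹.mulVec T) = T := by
      rw [Matrix.mulVec_mulVec, Matrix.mul_nonsing_inv _ hunit, Matrix.one_mulVec]
    rw [← congrFun h2 m]
    simp only [Matrix.mulVec, dotProduct, christoffel, Finset.mul_sum, hT]
    exact Finset.sum_congr rfl fun k _ => Finset.sum_congr rfl fun l _ => by ring
  have hsymm : ∀ v w, fderiv ℝ (fderiv ℝ (localParam F x₀)) y v w =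
      fderiv ℝ (fderiv ℝ (localParam F x₀)) y w v :=
    (contDiffAt_localParam hF.isSmoothEmbedding x₀ hy).isSymmSndFDerivAt (by simp; norm_num)
  rw [h1, hT]
  simp only [hF.gramDeriv_eq x₀ hy]
  rw [hsymm (EuclideanSpace.single j (1 : ℝ)) (EuclideanSpace.single i (1 : ℝ)),
    hsymm (EuclideanSpace.single m (1 : ℝ)) (EuclideanSpace.single i (1 : ℝ)),
    hsymm (EuclideanSpace.single m (1 : ℝ)) (EuclideanSpace.single j (1 : ℝ)),
    real_inner_comm (fderiv ℝ (localParam F x₀) y (EuclideanSpace.single j (1 : ℝ)))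
      (fderiv ℝ (fderiv ℝ (localParam F x₀)) y (EuclideanSpace.single i (1 : ℝ))
          (EuclideanSpace.single m (1 : ℝ)))]
  ring

/-- This is the tangential part of the Gauss formula: pair `c'' = Df(y'') + D²f(y', y')` with `∂ₘf`
and replace the second-order term by Christoffel symbols. -/
theorem IsIsometricEmbedding.inner_acceleration (hF : IsIsometricEmbedding F) {σ : ℝ → M}
    {c : ℝ → EuclideanSpace ℝ (Fin N)} {u : ℝ} (h : ∀ᶠ t in 𝓝 u, F (σ t) = c t)
    (hσ : ContMDiffAt 𝓘(ℝ, ℝ) (𝓡 2) 2 σ u) (m : Fin 2) :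
    inner ℝ (deriv (deriv c) u)
      (fderiv ℝ (localParam F (σ u)) (extChartAt (𝓡 2) (σ u) (σ u))
        (EuclideanSpace.single m (1 : ℝ))) =
    (gramMatrix (σ u) (extChartAt (𝓡 2) (σ u) (σ u))).mulVec (covariantAcceleration σ u) m := by
  have hy₀ := mem_extChartAt_target (I := 𝓡 2) (σ u)
  have hf := contDiffAt_localParam hF.isSmoothEmbedding (σ u) hy₀
  -- The chart stays the one around `σ u` while `t` moves, as in `covariantAcceleration σ u`.
  set y : ℝ → EuclideanSpace ℝ (Fin 2) := fun t => extChartAt (𝓡 2) (σ u) (σ t) with hydef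
  have hext : ContMDiffAt (𝓡 2) 𝓘(ℝ, EuclideanSpace ℝ (Fin 2)) 2 (extChartAt (𝓡 2) (σ u)) (σ u) :=
    (contMDiffAt_extChartAt (n := 3)).of_le (by norm_num)
  have hy : ContDiffAt ℝ 2 y u := (hext.comp u hσ).contDiffAt
  have hcy : c =ᶠ[𝓝 u] localParam F (σ u) ∘ y := by
    filter_upwards [h, hσ.continuousAt.eventually (extChartAt_source_mem_nhds (I := 𝓡 2) (σ u))]
      with t ht ht'
    simp only [localParam, hydef, Function.comp_apply, (extChartAt (𝓡 2) (σ u)).left_inv ht', ht]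
  have hcoord : ∀ z : ℝ → EuclideanSpace ℝ (Fin 2), ∀ t, DifferentiableAt ℝ z t → ∀ k,
      deriv (fun t => z t k) t = deriv z t k := fun z t hz k =>
    ((EuclideanSpace.proj (𝕜 := ℝ) k).hasFDerivAt.comp_hasDerivAt t hz.hasDerivAt).deriv
  have hy1 : ∀ k, deriv (coordCurve (σ u) σ k) u = deriv y u k :=
    hcoord y u (hy.differentiableAt two_ne_zero)
  have hyd : DifferentiableAt ℝ (deriv y) u :=
    differentiableAt_deriv_of_contDiffAt hy
  have hy2 : ∀ k, deriv (deriv (coordCurve (σ u) σ k)) u = deriv (deriv y) u k := fun k => by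
    have : deriv (coordCurve (σ u) σ k) =ᶠ[𝓝 u] fun t => deriv y t k := by
      filter_upwards [hy.eventually (by simp)] with t ht
      exact hcoord y t (ht.differentiableAt two_ne_zero) k
    rw [this.deriv_eq, hcoord _ u hyd]
  have hbasis : ∀ w : EuclideanSpace ℝ (Fin 2), w = w 0 • EuclideanSpace.single 0 (1 : ℝ) +
      w 1 • EuclideanSpace.single 1 (1 : ℝ) := fun w => by
    ext k; fin_cases k <;> simp
  have hacc : deriv (deriv c) u = _ :=
    hcy.deriv.deriv_eq.trans (deriv_deriv_comp (hf.of_le (by norm_num)) hy)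
  rw [hacc, show y u = extChartAt (𝓡 2) (σ u) (σ u) from rfl, hbasis (deriv (deriv y) u),
    hbasis (deriv y u)]
  simp only [Matrix.mulVec, dotProduct, covariantAcceleration, hy1, hy2, map_add, map_smul,
    add_apply, smul_apply, inner_add_left, real_inner_smul_left,
    ← hF.sum_gramMatrix_mul_christoffel (σ u) hy₀, ← hF.gramMatrix_eq (σ u) hy₀,
    Fin.sum_univ_two]
  have hsymm : ∀ i j, gramMatrix (σ u) (extChartAt (𝓡 2) (σ u) (σ u)) i j =
      gramMatrix (σ u) (extChartAt (𝓡 2) (σ u) (σ u)) j i := fun i j => by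
    rw [hF.gramMatrix_eq _ hy₀, hF.gramMatrix_eq _ hy₀, real_inner_comm]
  rw [hsymm 0 m, hsymm 1 m]
  ring

/-- The pairings of `c''` with the basis `∂ₘf` of the tangent space are the entries of `g · ∇_{σ'}
σ'`, and `g` is invertible. -/
theorem IsIsometricEmbedding.covariantAcceleration_eq_zero_iff (hF : IsIsometricEmbedding F)
    {σ : ℝ → M} {c : ℝ → EuclideanSpace ℝ (Fin N)} {u : ℝ} (h : ∀ᶠ t in 𝓝 u, F (σ t) = c t)
    (hσ : ContMDiffAt 𝓘(ℝ, ℝ) (𝓡 2) 2 σ u) :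
    (∀ k, covariantAcceleration σ u k = 0) ↔
      ∀ v ∈ tangentVectors (range F) (c u), inner ℝ (deriv (deriv c) u) v = 0 := by
  rw [← h.self_of_nhds, tangentVectors_range hF.isSmoothEmbedding, forall_mem_range]
  have key := hF.inner_acceleration h hσ
  constructor
  · intro hk w
    have hz : covariantAcceleration σ u = 0 := funext hk
    have hbasis : w = w 0 • EuclideanSpace.single 0 (1 : ℝ) +
        w 1 • EuclideanSpace.single 1 (1 : ℝ) := by
      ext k; fin_cases k <;> simp
    rw [hbasis]
    simp only [map_add, map_smul, inner_add_right, real_inner_smul_right, key, hz,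
      Matrix.mulVec_zero, Pi.zero_apply, mul_zero, add_zero]
  · intro hv
    have h0 : (gramMatrix (σ u) (extChartAt (𝓡 2) (σ u) (σ u))).mulVec
        (covariantAcceleration σ u) = 0 := funext fun m => by rw [← key m, hv]; rfl
    exact congrFun (Matrix.eq_zero_of_mulVec_eq_zero
      (hF.det_gramMatrix_ne_zero (σ u) (mem_extChartAt_target (I := 𝓡 2) (σ u))) h0)

end Geodesic

/-! ### Invariance of the total curvature -/

section TotalCurvature

variable {N : ℕ} {M : Type*} [TopologicalSpace M] [ChartedSpace (EuclideanSpace ℝ (Fin 2)) M]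
  [RiemannianBundle (fun x : M => TangentSpace (𝓡 2) x)] {F : M → EuclideanSpace ℝ (Fin N)}

theorem IsIsometricEmbedding.rotation_eq (hF : IsIsometricEmbedding F) {γ P : ℝ → M}
    {Q : ℝ → EuclideanSpace ℝ (Fin N)} {a b : ℝ} {n : ℕ} {t : ℕ → ℝ}
    (hQ : ∀ i < n, ∀ u ∈ Icc (t i) (t (i + 1)), F (P u) = Q u)
    (h : IsInscribedPolygonal IsGeodesicSegment γ a b n t P) :
    rotation euclideanTurningAngle n t Q = rotation turningAngle n t P := by
  refine Finset.sum_congr rfl fun i hi => ?_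
  have hi : i < n - 1 := Finset.mem_range.1 hi
  have h₁ : i < n := by omega
  have h₂ : i + 1 < n := by omega
  exact hF.euclideanTurningAngle_eq (h.lt_succ i h₁) (h.lt_succ (i + 1) h₂) (hQ i h₁)
    (hQ (i + 1) h₂) (h.segment i h₁).contMDiffOn (h.segment (i + 1) h₂).contMDiffOn

theorem IsIsometricEmbedding.modulus_eq (hF : IsIsometricEmbedding F) (γ : ℝ → M) (n : ℕ)
    (t : ℕ → ℝ) :
    modulus (surfaceEDist (range F)) (F ∘ γ) n t = modulus (riemannianEDist (𝓡 2)) γ n t := by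
  simp only [modulus, Function.comp_apply, hF.surfaceEDist_eq]

variable [IsManifold (𝓡 2) 3 M]

theorem IsIsometricEmbedding.isGeodesicSegment_iff (hF : IsIsometricEmbedding F) {σ : ℝ → M}
    {c : ℝ → EuclideanSpace ℝ (Fin N)} {r s : ℝ} (hrs : r ≤ s)
    (h : ∀ t ∈ Icc r s, F (σ t) = c t) :
    IsGeodesicSegment σ r s ↔ IsSurfaceGeodesicSegment (range F) c r s := by
  have hsmooth := contMDiffOn_iff_of_embedding hF.isSmoothEmbedding (n := 2) (by norm_num) h
  have hgeo : ContMDiffOn 𝓘(ℝ, ℝ) (𝓡 2) 2 σ (Icc r s) → ∀ u ∈ Ioo r s,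
      ((∀ k, covariantAcceleration σ u k = 0) ↔
        ∀ v ∈ tangentVectors (range F) (c u), inner ℝ (deriv (deriv c) u) v = 0) :=
    fun hσ u hu => by
      -- At interior times `[r, s]` is a neighbourhood of `u`, so agreement there determines the
      -- two-sided derivatives of `c`.
      have hnhds := Icc_mem_nhds hu.1 hu.2
      exact hF.covariantAcceleration_eq_zero_iff (by filter_upwards [hnhds] with t ht using h t ht)
        (hσ.contMDiffAt hnhds)
  have hlen : ContMDiffOn 𝓘(ℝ, ℝ) (𝓡 2) 2 σ (Icc r s) →
      (curveLength c r s = surfaceEDist (range F) (c r) (c s) ↔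
        pathELength (𝓡 2) σ r s = riemannianEDist (𝓡 2) (σ r) (σ s)) := fun hσ => by
    rw [hF.curveLength_eq h (hσ.of_le (by norm_num)), ← h r (left_mem_Icc.2 hrs),
      ← h s (right_mem_Icc.2 hrs), hF.surfaceEDist_eq]
  constructor
  · rintro ⟨h1, h2, h3⟩
    exact ⟨hsmooth.1 h1, fun u hu => ⟨σ u, h u hu⟩, fun u hu => (hgeo h1 u hu).1 (h2 u hu),
      (hlen h1).2 h3⟩
  · rintro ⟨h1, -, h2, h3⟩
    have h1 := hsmooth.2 h1
    exact ⟨h1, fun u hu => (hgeo h1 u hu).2 (h2 u hu), (hlen h1).1 h3⟩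

/-- The vertex condition `hv` is separate because for `n = 0` there is a vertex but no segment, and
`hQ` is empty. -/
theorem IsIsometricEmbedding.isInscribedPolygonal_iff (hF : IsIsometricEmbedding F) {γ P : ℝ → M}
    {Q : ℝ → EuclideanSpace ℝ (Fin N)} {a b : ℝ} {n : ℕ} {t : ℕ → ℝ}
    (hv : ∀ i ≤ n, F (P (t i)) = Q (t i))
    (hQ : ∀ i < n, ∀ u ∈ Icc (t i) (t (i + 1)), F (P u) = Q u) :
    IsInscribedPolygonal IsGeodesicSegment γ a b n t P ↔
      IsInscribedPolygonal (IsSurfaceGeodesicSegment (range F)) (F ∘ γ) a b n t Q := by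
  have hinj := hF.isSmoothEmbedding.isEmbedding.injective
  constructor
  · intro h
    exact ⟨h.left_le, h.le_right, h.lt_succ,
      fun i hi => by rw [← hv i hi, h.vertex i hi, Function.comp_apply],
      fun i hi => hinj.ne (h.ne_succ i hi),
      fun i hi => (hF.isGeodesicSegment_iff (h.lt_succ i hi).le (hQ i hi)).1 (h.segment i hi)⟩
  · intro h
    exact ⟨h.left_le, h.le_right, h.lt_succ,
      fun i hi => hinj ((hv i hi).trans (h.vertex i hi)),
      fun i hi => fun heq => h.ne_succ i hi (congrArg F heq),
      fun i hi => (hF.isGeodesicSegment_iff (h.lt_succ i hi).le (hQ i hi)).2 (h.segment i hi)⟩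

theorem IsIsometricEmbedding.supRotation_eq (hF : IsIsometricEmbedding F) (γ : ℝ → M)
    (a b ε : ℝ) :
    supRotation (riemannianEDist (𝓡 2)) IsGeodesicSegment turningAngle γ a b ε =
      supRotation (surfaceEDist (range F)) (IsSurfaceGeodesicSegment (range F))
        euclideanTurningAngle (F ∘ γ) a b ε := by
  refine iSup_congr fun n => iSup_congr fun t => le_antisymm ?_ ?_
  · refine iSup_mono' fun P => ⟨F ∘ P, ?_⟩
    refine iSup_mono' fun h => ⟨(hF.isInscribedPolygonal_iff (fun _ _ => rfl)
      (fun _ _ _ _ => rfl)).1 h, ?_⟩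
    rw [hF.modulus_eq, hF.rotation_eq (Q := F ∘ P) (fun _ _ _ _ => rfl) h]
  · have : Nonempty M := ⟨γ a⟩
    -- Off its vertices and segments `Q` may leave `range F`, where `invFun` is arbitrary; only its
    -- values on them matter, and those lie in `range F` once `Q` is inscribed.
    refine iSup_mono' fun Q => ⟨Function.invFun F ∘ Q, ?_⟩
    refine iSup_le fun h => ?_
    have hv : ∀ i ≤ n, F ((Function.invFun F ∘ Q) (t i)) = Q (t i) := fun i hi =>
      Function.invFun_eq ⟨γ (t i), (h.vertex i hi).symm⟩
    have hQ : ∀ i < n, ∀ u ∈ Icc (t i) (t (i + 1)), F ((Function.invFun F ∘ Q) u) = Q u :=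
      fun i hi u hu => Function.invFun_eq ((h.segment i hi).mem u hu)
    have hP := (hF.isInscribedPolygonal_iff hv hQ).2 h
    refine le_iSup_of_le hP ?_
    rw [hF.modulus_eq, hF.rotation_eq hQ hP]

theorem IsIsometricEmbedding.intrinsicTC_eq_surfaceTC (hF : IsIsometricEmbedding F) (γ : ℝ → M)
    (a b : ℝ) : intrinsicTC γ a b = surfaceTC (range F) (F ∘ γ) a b :=
  iInf_congr fun ε => iInf_congr fun _ => hF.supRotation_eq γ a b ε

end TotalCurvature

end CurveOnSurface

end

theorem proposition6p2 {M : Type*} [TopologicalSpace M] [T2Space M] [CompactSpace M]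
    [ChartedSpace (EuclideanSpace ℝ (Fin 2)) M] [IsManifold (𝓡 2) 3 M]
    [RiemannianBundle (fun x : M => TangentSpace (𝓡 2) x)]
    [IsContMDiffRiemannianBundle (𝓡 2) 2 (EuclideanSpace ℝ (Fin 2))
      (fun x : M => TangentSpace (𝓡 2) x)]
    (a b : ℝ) (γ : ℝ → M) (hγ : CurveOnSurface.IsPiecewiseSmooth γ a b) :
    (∀ (N : ℕ) (F : M → EuclideanSpace ℝ (Fin N)), CurveOnSurface.IsIsometricEmbedding F →
      CurveOnSurface.intrinsicTC γ a b =
        CurveOnSurface.surfaceTC (Set.range F) (F ∘ γ) a b) ∧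
    (∀ (N₁ N₂ : ℕ) (F₁ : M → EuclideanSpace ℝ (Fin N₁)) (F₂ : M → EuclideanSpace ℝ (Fin N₂)),
      CurveOnSurface.IsIsometricEmbedding F₁ → CurveOnSurface.IsIsometricEmbedding F₂ →
      CurveOnSurface.surfaceTC (Set.range F₁) (F₁ ∘ γ) a b =
        CurveOnSurface.surfaceTC (Set.range F₂) (F₂ ∘ γ) a b) := by
  have key : ∀ (N : ℕ) (F : M → EuclideanSpace ℝ (Fin N)),
      CurveOnSurface.IsIsometricEmbedding F → CurveOnSurface.intrinsicTC γ a b =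
        CurveOnSurface.surfaceTC (Set.range F) (F ∘ γ) a b :=
    fun _ _ hF => hF.intrinsicTC_eq_surfaceTC γ a b
  exact ⟨key, fun N₁ N₂ F₁ F₂ h₁ h₂ => (key N₁ F₁ h₁).symm.trans (key N₂ F₂ h₂)⟩
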